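/- Let $p$ be an odd prime number and $K$ a field of characteristic $p$. For a power series $f \in K[[z]]$ with $f(0)=0$ and $f(z) \neq z$, let $\operatorname{mult}(f)$ be the lowest degree of a nonzero term of $f(z)-z$ (and put $\operatorname{mult}(f)=+\infty$ if $f(z)=z$), let $\operatorname{ind}(f) \in K$ be the coefficient of $\frac1z$ in the Laurent series expansion about $0$ of $\frac{1}{z-f(z)}$, and let $$\operatorname{resit}(f) = \tfrac12 \operatorname{mult}(f) - \operatorname{ind}(f) \in K .$$ Let $q \in \{1,\dots,p-1\}$ and let $f \in K[[z]]$ be a power series with $f(0)=0$ and $\operatorname{mult}(f)=q+1$. For each integer $n \ge 0$ put $i_n(f) = \operatorname{mult}(f^{p^n})-1$, where $f^{m}$ denotes the $m$-fold composition of $f$ with itself. Then $f$ is $q$-ramified, that is, $$i_n(f) = q(1+p+\cdots+p^n) \quad \text{for every integer } n \ge 0,$$ if and only if $\operatorname{resit}(f) \neq 0$. -/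

import Mathlib

open scoped PowerSeries

namespace Ramification

noncomputable section

/-- The multiplicity of `0` as a fixed point of the power series `f`: the lowest degree of a
nonzero term of `f(z) - z`; it is `⊤` exactly when `f(z) = z`. (For `f(0) ≠ 0` it is `0`.) -/
def mult {K : Type*} [Field K] (f : K⟦X⟧) : ℕ∞ :=
  (f - PowerSeries.X).order

/-- The `m`-fold composition `f ∘ ⋯ ∘ f` of a power series `f` with `f(0) = 0`.
Here `PowerSeries.subst f g` is the composition `g(f(z))`. -/
def iter {K : Type*} [Field K] (f : K⟦X⟧) : ℕ → K⟦X⟧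
  | 0 => PowerSeries.X
  | m + 1 => PowerSeries.subst f (iter f m)

/-- The `n`-th lower ramification number `i_n(f) = mult(f^{p^n}) - 1` of a wildly ramified power
series `f` over a field of characteristic `p`; it is `⊤` exactly when `f^{p^n}(z) = z`. -/
def lowerRamification {K : Type*} [Field K] (p : ℕ) (f : K⟦X⟧) (n : ℕ) : ℕ∞ :=
  mult (iter f (p ^ n)) - 1

/-- `f` is `q`-ramified: `i_n(f) = q (1 + p + ⋯ + p^n)` for every `n ≥ 0`. -/
def IsQRamified {K : Type*} [Field K] (p q : ℕ) (f : K⟦X⟧) : Prop :=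
  ∀ n : ℕ, lowerRamification p f n = ((q * ∑ j ∈ Finset.range (n + 1), p ^ j : ℕ) : ℕ∞)

/-- The residue fixed point index of `f` at `0`: the coefficient of `1/z` in the Laurent series
expansion of `1/(z - f(z))`, for `f(0) = 0` and `f(z) ≠ z`. -/
def ind {K : Type*} [Field K] (f : K⟦X⟧) : K :=
  ((HahnSeries.ofPowerSeries ℤ K (PowerSeries.X - f))⁻¹ : LaurentSeries K).coeff (-1)

/-- The iterative residue `resit(f) = mult(f)/2 - ind(f)` in `K`, for `f(0) = 0` and
`f(z) ≠ z`. -/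
def resit {K : Type*} [Field K] (f : K⟦X⟧) : K :=
  ((mult f).toNat : K) / 2 - ind f

end

end Ramification

namespace Ramification

open PowerSeries

/-! ### How endomorphisms close to the identity change orders -/

section Endomorphism

variable {K : Type*} [Field K]

/-! Let `T` be composition with `f` and `δ = T - 1`. Integrating the polar part of `1 / (f - X)`
without its residue term gives an approximate Abel function `w = U / X ^ q`, whose increment is `v =
T w - w = 1 - a * resit f * X ^ q + ⋯` with `a ≠ 0` (`exists_approximate_abel`). Telescoping, and `∑
τ ^ i = (τ - 1) ^ (p ^ n - 1)` over `i < p ^ n` in characteristic `p`, turn `T ^ (p ^ n) w - w` into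
`V n = δ ^ (p ^ n - 1) v`; as `w` has a pole of order `q` prime to `p`, `i_n(f) = ord (V n) + q`
(`order_map_X_sub_X`).

Each `δ` raises orders by at least `q`, so `resit f = 0` already makes `i_1(f)` too large. If `resit
f ≠ 0`, let `s = ord (V n)`, a multiple of `p`, and `G = T ^ (p ^ n)`. Since `T` commutes with `G`,
`T (V n) - V n = G (v - 1) - (v - 1)` has known order `s + 2 * q`; this forces `G (V n) - V n` to
have order `2 * (s + q)` (`order_map_sub_of_order_commuting`). Then `p - 2` further applications of
`G - 1` add `s + q` each, giving `ord (V (n + 1)) = p * (s + q)`. -/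

lemma order_eq_nat_iff_X_pow_dvd {h : K⟦X⟧} {k : ℕ} :
    h.order = k ↔ X ^ k ∣ h ∧ coeff k h ≠ 0 := by
  rw [order_eq_nat, X_pow_dvd_iff, and_comm]

lemma X_pow_dvd_of_order_eq {h : K⟦X⟧} {k : ℕ} (hk : h.order = k) : X ^ k ∣ h :=
  (order_eq_nat_iff_X_pow_dvd.1 hk).1

lemma exists_one_add_pow {R : Type*} [CommRing R] (y : R) (k : ℕ) :
    ∃ c, (1 + y) ^ k = 1 + k * y + y ^ 2 * c := by
  induction k with
  | zero => exact ⟨0, by simp⟩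
  | succ k ih =>
    obtain ⟨c, hc⟩ := ih
    exact ⟨k + c + y * c, by rw [pow_succ, hc]; push_cast; ring⟩

/-- An endomorphism moving `X` by a multiple of `X ^ (Q + 1)` moves every series by one. -/
lemma X_pow_dvd_map_sub (G : K⟦X⟧ →ₐ[K] K⟦X⟧) {Q : ℕ} (hG : X ^ (Q + 1) ∣ G X - X)
    (h : K⟦X⟧) : X ^ (Q + 1) ∣ G h - h := by
  suffices H : ∀ j ≤ Q + 1, ∀ h : K⟦X⟧, X ^ j ∣ G h - h from H _ le_rfl h
  intro j
  induction j with
  | zero => intro _ h; simp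
  | succ j ih =>
    intro hj h
    have hC : ∀ c : K, G (C c) = C c := fun c ↦ G.commutes c
    obtain ⟨r, hr⟩ := ih (by omega) (PowerSeries.mk fun n ↦ coeff (n + 1) h)
    obtain ⟨F, hF⟩ := (pow_dvd_pow X hj).trans hG
    have h1 := eq_X_mul_shift_add_const h
    set g := PowerSeries.mk fun n ↦ coeff (n + 1) h
    have h2 : G h = G X * G g + C (constantCoeff h) := by
      conv_lhs => rw [h1]
      rw [map_add, map_mul, hC]
    refine ⟨F * G g + r, ?_⟩
    rw [h2]
    nth_rewrite 2 [h1]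
    linear_combination G g * hF + X * hr

/-- With `G X = X * (1 + X ^ Q * F)`, the leading change comes from the linear term `k * X ^ Q * F`
of the binomial expansion. The factor `k` is why exponents divisible by `p` need separate care. -/
lemma map_sub_of_X_pow_dvd (G : K⟦X⟧ →ₐ[K] K⟦X⟧) {Q : ℕ} (hQ : 1 ≤ Q)
    (hG : X ^ (Q + 1) ∣ G X - X) {k : ℕ} {h : K⟦X⟧} (hk : X ^ k ∣ h) :
    X ^ (k + Q) ∣ G h - h ∧
      coeff (k + Q) (G h - h) = k * coeff (Q + 1) (G X - X) * coeff k h := by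
  obtain ⟨g, rfl⟩ := hk
  obtain ⟨r, hr⟩ := X_pow_dvd_map_sub G hG g
  obtain ⟨F, hF⟩ := hG
  obtain ⟨Q, rfl⟩ : ∃ n, Q = n + 1 := ⟨Q - 1, by omega⟩
  obtain ⟨c, hc⟩ := exists_one_add_pow (X ^ (Q + 1) * F) k
  have hX : G X = X * (1 + X ^ (Q + 1) * F) := by linear_combination hF
  have key : G (X ^ k * g) - X ^ k * g = X ^ (k + (Q + 1)) *
      ((k : K⟦X⟧) * F * g + X * (X ^ Q * F ^ 2 * c * g +
        (1 + (k : K⟦X⟧) * (X ^ (Q + 1) * F) + (X ^ (Q + 1) * F) ^ 2 * c) * r)) := by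
    rw [map_mul, map_pow, hX, mul_pow, hc, eq_add_of_sub_eq hr]
    ring
  refine ⟨⟨_, key⟩, ?_⟩
  rw [key, hF]
  have h0 : ∀ (n : ℕ) (B : K⟦X⟧), coeff n (X ^ n * B) = constantCoeff B := fun n B ↦ by
    simpa using coeff_X_pow_mul B n 0
  simp only [h0]
  simp

lemma order_map_sub (G : K⟦X⟧ →ₐ[K] K⟦X⟧) {Q : ℕ} (hQ : 1 ≤ Q)
    (hG : (G X - X).order = ((Q + 1 : ℕ) : ℕ∞)) {k : ℕ} (hk0 : (k : K) ≠ 0) {h : K⟦X⟧}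
    (hk : h.order = k) : (G h - h).order = ((k + Q : ℕ) : ℕ∞) := by
  rw [order_eq_nat_iff_X_pow_dvd] at *
  have := map_sub_of_X_pow_dvd G hQ hG.1 hk.1
  refine ⟨this.1, ?_⟩
  rw [this.2]
  exact mul_ne_zero (mul_ne_zero hk0 hG.2) hk.2

lemma eq_zero_of_forall_X_pow_dvd {h : K⟦X⟧} (H : ∀ n, X ^ (n + 1) ∣ h) : h = 0 := by
  ext n
  exact X_pow_dvd_iff.1 (H n) n n.lt_succ_self

/-- If `V = G w - w` with `w = U / X ^ q`, then the order of `V` determines that of `G X - X`. -/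
lemma order_map_X_sub_X (G : K⟦X⟧ →ₐ[K] K⟦X⟧) (hG : X ^ 2 ∣ G X - X) {q : ℕ}
    (hq : (q : K) ≠ 0) {U V : K⟦X⟧} (hU : constantCoeff U ≠ 0)
    -- This is `V = G w - w` with denominators cleared, so that `G` need only act on power series.
    (hV : V * X ^ q * G X ^ q = X ^ q * G U - U * G X ^ q) :
    (G X - X).order = V.order + q + 1 := by
  have hGX : (G X).order = 1 := by
    have h2 : coeff 1 (G X - X) = 0 := X_pow_dvd_iff.1 hG 1 (by norm_num)
    have h1 : X ∣ G X := by
      have := dvd_add ((Dvd.intro_left _ (pow_succ X 1).symm).trans hG) (dvd_refl (X : K⟦X⟧))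
      simpa using this
    rw [← Nat.cast_one, order_eq_nat_iff_X_pow_dvd, pow_one]
    refine ⟨h1, ?_⟩
    rw [map_sub, sub_eq_zero] at h2
    simp [h2]
  have hord : (X ^ q * G U - U * G X ^ q).order = V.order + q + q := by
    rw [← hV, order_mul, order_mul, order_X_pow, order_pow, hGX]
    simp
  by_cases hX : G X = X
  · have hGU : G U = U := by
      refine sub_eq_zero.1 (eq_zero_of_forall_X_pow_dvd fun n ↦ X_pow_dvd_map_sub G ?_ U)
      simp [hX]
    rw [hGU, hX, mul_comm, sub_self, order_zero] at hord
    rw [hX, sub_self, order_zero]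
    have : V.order = ⊤ := by
      by_contra h
      obtain ⟨n, hn⟩ := ENat.ne_top_iff_exists.1 h
      rw [← hn] at hord
      exact absurd hord (by exact_mod_cast ENat.top_ne_natCast _)
    simp [this]
  · have hne : G X - X ≠ 0 := sub_ne_zero.2 hX
    obtain ⟨n, hn⟩ := ENat.ne_top_iff_exists.1 (mt order_eq_top.1 hne)
    have h2n : 2 ≤ n := by
      by_contra h
      have := (order_eq_nat_iff_X_pow_dvd.1 hn.symm).2
      exact this (X_pow_dvd_iff.1 hG n (by omega))
    obtain ⟨Q, rfl⟩ : ∃ Q, n = Q + 1 := ⟨n - 1, by omega⟩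
    have hnG := order_eq_nat_iff_X_pow_dvd.1 hn.symm
    obtain ⟨r, hr⟩ := X_pow_dvd_map_sub G hnG.1 U
    obtain ⟨⟨B, hB⟩, hB'⟩ := map_sub_of_X_pow_dvd G (by omega) hnG.1 (dvd_refl ((X : K⟦X⟧) ^ q))
    have h0 : ∀ (n : ℕ) (B : K⟦X⟧), coeff n (X ^ n * B) = constantCoeff B := fun n B ↦ by
      simpa using coeff_X_pow_mul B n 0
    have hR : X ^ q * G U - U * G X ^ q = X ^ (q + Q) * (X * r - U * B) := by
      rw [map_pow] at hB
      linear_combination X ^ q * hr - U * hB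
    have hRo : (X ^ q * G U - U * G X ^ q).order = ((q + Q : ℕ) : ℕ∞) := by
      rw [order_eq_nat_iff_X_pow_dvd, hR, h0]
      refine ⟨dvd_mul_right _ _, ?_⟩
      rw [hB, h0] at hB'
      rw [coeff_X_pow_self, mul_one] at hB'
      have hB0 : constantCoeff B ≠ 0 := by rw [hB']; exact mul_ne_zero hq hnG.2
      simp [hU, hB0]
    rw [hRo] at hord
    have hVt : V.order ≠ ⊤ := by
      intro h
      rw [h] at hord
      exact absurd hord (by simp)
    obtain ⟨m, hm⟩ := ENat.ne_top_iff_exists.1 hVt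
    rw [← hm] at hord ⊢
    rw [← hn]
    norm_cast at hord ⊢
    omega

section CharP

variable {p : ℕ} [Fact p.Prime] [CharP K p]

/-- For `p ∣ s`, `X ^ s` is a power of `X ^ p`, so by Frobenius its relative change under `G` is
`O(X ^ (p * Q))` instead of `O(X ^ Q)`. -/
lemma exists_map_sub_eq (G : K⟦X⟧ →ₐ[K] K⟦X⟧) {Q : ℕ} (hG : X ^ (Q + 1) ∣ G X - X) {s : ℕ}
    (hs : p ∣ s) (c : K) (h : K⟦X⟧) :
    ∃ r, G (X ^ s * (C c + h)) - X ^ s * (C c + h) =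
      X ^ s * (G h - h + X ^ (p * Q) * r) := by
  have : CharP K⟦X⟧ p := charP_of_injective_algebraMap (algebraMap K K⟦X⟧).injective p
  obtain ⟨k, rfl⟩ := hs
  obtain ⟨F, hF⟩ := hG
  obtain ⟨d, hd⟩ := exists_one_add_pow (X ^ (p * Q) * F ^ p) k
  have h1 : G X ^ p = X ^ p * (1 + X ^ (p * Q) * F ^ p) := by
    have := sub_pow_char (p := p) (G X) X
    rw [hF] at this
    rw [eq_add_of_sub_eq this.symm]
    ring
  have hC : G (C c) = C c := G.commutes c
  refine ⟨((k : K⟦X⟧) * F ^ p + X ^ (p * Q) * F ^ p * F ^ p * d) * (C c + G h), ?_⟩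
  rw [map_mul, map_pow, map_add, hC, pow_mul (G X), h1, mul_pow, hd]
  ring

/-- The term of `v` in degree `s` is nearly invariant because `p ∣ s`. The order of `T v - v` shows
that the next term lies in degree `s + q`, and `G` moves that one with the nonzero factor `q`. -/
lemma order_map_sub_of_order_commuting (hp3 : 3 ≤ p) (T G : K⟦X⟧ →ₐ[K] K⟦X⟧) {q s : ℕ}
    (hq1 : 1 ≤ q) (hqp : q < p) (hT : (T X - X).order = ((q + 1 : ℕ) : ℕ∞)) (hs : p ∣ s)
    (hG : (G X - X).order = ((s + q + 1 : ℕ) : ℕ∞)) {v : K⟦X⟧} (hv : X ^ s ∣ v)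
    (hTv : (T v - v).order = ((s + 2 * q : ℕ) : ℕ∞)) :
    (G v - v).order = ((2 * (s + q) : ℕ) : ℕ∞) := by
  have hne : ∀ j, 1 ≤ j → j < p → (j : K) ≠ 0 := fun j h1 h2 h ↦ by
    rw [CharP.cast_eq_zero_iff K p] at h
    exact absurd (Nat.le_of_dvd h1 h) (by omega)
  obtain ⟨v', rfl⟩ := hv
  obtain ⟨c, h, rfl, h1⟩ : ∃ (c : K) (h : K⟦X⟧), v' = C c + h ∧ X ^ 1 ∣ h :=
    ⟨constantCoeff v', v' - C (constantCoeff v'), by ring, by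
      rw [pow_one, X_dvd_iff]; simp⟩
  rw [order_eq_nat_iff_X_pow_dvd] at hT hG hTv ⊢
  obtain ⟨r, hr⟩ := exists_map_sub_eq (p := p) T hT.1 hs c h
  obtain ⟨r', hr'⟩ := exists_map_sub_eq (p := p) G hG.1 hs c h
  have hcs : ∀ (n : ℕ) (B : K⟦X⟧), coeff (s + n) (X ^ s * B) = coeff n B := fun n B ↦ by
    rw [add_comm]; exact coeff_X_pow_mul B s n
  -- The error term is invisible in these degrees because `2 * q < p * q`, as `p ≥ 3`.
  have hco : ∀ j, j ≤ 2 * q → coeff j (T h - h) = coeff (s + j) (X ^ s * (T h - h + X ^ (p * q) * r)) := by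
    intro j hj
    rw [hcs, map_add, X_pow_dvd_iff.1 (dvd_mul_right (X ^ (p * q)) r) j (by nlinarith), add_zero]
  -- A term of `h` in degree `j < q` would show up in `T h - h` in degree `j + q < 2 * q`, since `j`
  -- is prime to `p`.
  have hjq : ∀ j, 1 ≤ j → j ≤ q → X ^ j ∣ h := by
    intro j hj
    induction j, hj using Nat.le_induction with
    | base => exact fun _ ↦ h1
    | succ j hj ih =>
      intro hjq
      have hd := ih (by omega)
      have hm := (map_sub_of_X_pow_dvd T hq1 hT.1 hd).2
      rw [hco _ (by omega), ← hr, X_pow_dvd_iff.1 hTv.1 _ (by omega)] at hm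
      have hc0 : coeff j h = 0 := by
        have := hne j hj (by omega)
        exact (mul_eq_zero.1 hm.symm).resolve_left (mul_ne_zero this hT.2)
      rw [X_pow_dvd_iff] at hd ⊢
      intro i hi
      rcases Nat.lt_succ_iff_lt_or_eq.1 hi with hi | rfl
      · exact hd i hi
      · exact hc0
  have hq := hjq q hq1 le_rfl
  have hcq : coeff q h ≠ 0 := by
    have hm := (map_sub_of_X_pow_dvd T hq1 hT.1 hq).2
    rw [hco _ (by omega), ← hr, ← two_mul] at hm
    intro h0
    rw [h0, mul_zero] at hm
    exact hTv.2 hm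
  obtain ⟨hd, hm⟩ := map_sub_of_X_pow_dvd G (by omega) hG.1 hq
  have hle : q + (s + q) + 1 ≤ p * (s + q) := by nlinarith
  rw [hr', show 2 * (s + q) = s + (q + (s + q)) by ring]
  refine ⟨?_, ?_⟩
  · rw [pow_add]
    refine mul_dvd_mul_left _ (dvd_add hd ((pow_dvd_pow X ?_).trans (dvd_mul_right _ _)))
    omega
  · rw [hcs, map_add, X_pow_dvd_iff.1 (dvd_mul_right (X ^ (p * (s + q))) r') _ (by omega),
      add_zero, hm]
    exact mul_ne_zero (mul_ne_zero (hne q hq1 hqp) hG.2) hcq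

end CharP

end Endomorphism

/-! ### The residue index and the approximate Abel function -/

section Initial

variable {K : Type*} [Field K]

lemma ind_eq_neg_coeff {f F H : K⟦X⟧} {q : ℕ} (hf : f = X * (1 + X ^ q * F)) (hH : F * H = 1) :
    ind f = -coeff q H := by
  have h1 : (X - f : K⟦X⟧) = -(X ^ (q + 1) * F) := by rw [hf]; ring
  have h2 : (HahnSeries.ofPowerSeries ℤ K (X - f))⁻¹ =
      HahnSeries.single (-((q : ℤ) + 1)) (1 : K) * HahnSeries.ofPowerSeries ℤ K (-H) := by
    apply inv_eq_of_mul_eq_one_left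
    have h3 : HahnSeries.ofPowerSeries ℤ K (-(X ^ (q + 1) * F)) =
      HahnSeries.single ((q : ℤ) + 1) (1 : K) * HahnSeries.ofPowerSeries ℤ K (-F) := by
      rw [← mul_neg, map_mul, HahnSeries.ofPowerSeries_X_pow]
      simp
    rw [h1, h3, mul_mul_mul_comm, HahnSeries.single_mul_single, ← map_mul, neg_mul_neg,
      mul_comm H, hH]
    simp
  rw [ind, h2, HahnSeries.coeff_single_mul, one_mul,
    show -1 - -((q : ℤ) + 1) = (q : ℕ) by ring, HahnSeries.ofPowerSeries_apply_coeff]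
  simp

lemma exists_inv_one_add_pow {R : Type*} [CommRing R] {y r : R} (hr : r * (1 + y) = 1) (k : ℕ) :
    ∃ c, 2 * r ^ k = 2 - 2 * k * y + k * (k + 1) * y ^ 2 + y ^ 3 * c := by
  induction k with
  | zero => exact ⟨0, by simp⟩
  | succ k ih =>
    obtain ⟨c, hc⟩ := ih
    refine ⟨r * c - r * (k + 1) * (k + 2), ?_⟩
    rw [pow_succ, ← mul_assoc, hc]
    push_cast
    linear_combination (2 - 2 * (k + 1) * y + (k + 1) * (k + 2) * y ^ 2) * hr

/-- A primitive `w = U / X ^ q` of the polar part of `1 / (f - X)` satisfies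
`w ∘ f - w = 1 - a * resit f * X ^ q + ⋯`. -/
lemma exists_approximate_abel {q : ℕ} (hq1 : 1 ≤ q) (hq : ∀ k, 1 ≤ k → k ≤ q → (k : K) ≠ 0)
    (h2 : (2 : K) ≠ 0) (T : K⟦X⟧ →ₐ[K] K⟦X⟧) (hT : mult (T X) = (q : ℕ∞) + 1) :
    ∃ U v : K⟦X⟧, constantCoeff U ≠ 0 ∧ v * X ^ q * T X ^ q = X ^ q * T U - U * T X ^ q ∧
      X ^ q ∣ v - 1 ∧
      coeff q (v - 1) = -(coeff (q + 1) (T X - X) * resit (T X)) := by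
  have hT' := order_eq_nat_iff_X_pow_dvd.1
    (show (T X - X).order = ((q + 1 : ℕ) : ℕ∞) by simpa [mult] using hT)
  have hres : resit (T X) = ((q : K) + 1) / 2 - ind (T X) := by
    rw [resit, hT]
    norm_cast
  obtain ⟨⟨F, hF⟩, ha⟩ := hT'
  have hfF : T X = X * (1 + X ^ q * F) := by linear_combination hF
  have hcF : coeff (q + 1) (T X - X) = constantCoeff F := by
    rw [hF]; simpa using coeff_X_pow_mul F (q + 1) 0
  rw [hcF] at ha ⊢
  have hFH : F * F⁻¹ = 1 := PowerSeries.mul_inv_cancel F ha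
  rw [hres, ind_eq_neg_coeff hfF hFH]
  set H := F⁻¹
  have hH0 : constantCoeff H = (constantCoeff F)⁻¹ := constantCoeff_inv F
  have hPR : (1 + X ^ q * F)⁻¹ * (1 + X ^ q * F) = 1 := PowerSeries.inv_mul_cancel _ (by simp [show q ≠ 0 by omega])
  set R := (1 + X ^ q * F)⁻¹
  choose c hc using exists_inv_one_add_pow hPR
  have hhalf : C (2⁻¹ : K) * 2 = 1 := by
    rw [← map_ofNat (C (R := K)) 2, ← map_mul, inv_mul_cancel₀ h2, map_one]
  -- `E k = (T (X ^ (-k)) - X ^ (-k)) / X ^ (q - k)`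
  obtain ⟨E, hE⟩ : ∃ E : ℕ → K⟦X⟧, ∀ k : ℕ, E k = -((k : K⟦X⟧) * F) +
      C (2⁻¹ : K) * ((k : K⟦X⟧) * ((k : K⟦X⟧) + 1) * X ^ q * F ^ 2 + X ^ (2 * q) * F ^ 3 * c k) :=
    ⟨_, fun _ ↦ rfl⟩
  have hER : ∀ k, R ^ k = 1 + X ^ q * E k := by
    intro k
    rw [hE]
    linear_combination (C (2⁻¹ : K)) * hc k - (R ^ k - 1 + X ^ q * F * k) * hhalf
  -- Here `1 / (f - X) = H / X ^ (q + 1)`, so `m j` is the coefficient of `X ^ (j - q)` in the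
  -- primitive; `j = q` would be the residue term.
  let m : ℕ → K := fun j ↦ coeff j H / ((j : K) - q)
  have hm : ∀ j < q, m j * ((j : K) - q) = coeff j H := by
    intro j hj
    refine div_mul_cancel₀ _ ?_
    have := hq (q - j) (by omega) (by omega)
    rw [Nat.cast_sub hj.le] at this
    rwa [← neg_sub, neg_ne_zero]
  clear_value m
  refine ⟨∑ j ∈ Finset.range q, C (m j) * X ^ j,
    ∑ j ∈ Finset.range q, C (m j) * X ^ j * E (q - j), ?_, ?_, ?_⟩
  · rw [map_sum, Finset.sum_eq_single 0]
    · have := hm 0 hq1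
      simp only [pow_zero, mul_one]
      intro h
      simp only [constantCoeff_C] at h
      rw [h, zero_mul] at this
      simp [hH0] at this
      exact ha this.symm
    · intro j _ hj
      simp [hj]
    · simp; omega
  · have hC : ∀ c : K, T (C c) = C c := fun c ↦ T.commutes c
    have hTR : T X * R = X := by rw [hfF]; linear_combination X * hPR
    simp only [map_sum, map_mul, map_pow, hC, Finset.mul_sum, Finset.sum_mul]
    rw [← Finset.sum_sub_distrib]
    refine Finset.sum_congr rfl fun j hj ↦ ?_
    have hj' : j < q := Finset.mem_range.1 hj
    have h1 := hER (q - j)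
    obtain ⟨k, rfl⟩ : ∃ k, q = j + k := ⟨q - j, by omega⟩
    rw [Nat.add_sub_cancel_left] at h1 ⊢
    have h3 : R ^ k * T X ^ k = X ^ k := by rw [← mul_pow, mul_comm, hTR]
    linear_combination (C (m j) * X ^ j * T X ^ (j + k)) * (-h1) +
      C (m j) * X ^ j * T X ^ j * h3
  · obtain ⟨H', hH'⟩ : ∃ H', H = ∑ j ∈ Finset.range q, C (coeff j H) * X ^ j + X ^ q * H' := by
      have : X ^ q ∣ H - ∑ j ∈ Finset.range q, C (coeff j H) * X ^ j := by
        rw [X_pow_dvd_iff]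
        intro i hi
        simp [coeff_C_mul, coeff_X_pow, hi]
      obtain ⟨H', h⟩ := this
      exact ⟨H', by rw [← h]; ring⟩
    have hqH : coeff q H = constantCoeff H' := by
      have h0 : coeff q (X ^ q * H') = constantCoeff H' := by
        simpa using coeff_X_pow_mul H' q 0
      rw [← h0]
      conv_lhs => rw [hH']
      simp [coeff_C_mul, coeff_X_pow]
    -- `W` collects the contributions to `v` beyond first order in `F`. Its constant term supplies
    -- the `mult f / 2` part of `resit`, while the omitted tail `H'` of `H` supplies `ind`.
    set W : K⟦X⟧ := ∑ j ∈ Finset.range q, C (m j) * X ^ j * (C (2⁻¹ : K) *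
      (((q - j : ℕ) : K⟦X⟧) * (((q - j : ℕ) : K⟦X⟧) + 1) * F ^ 2 + X ^ q * F ^ 3 * c (q - j)))
      with hW
    have hW0 : constantCoeff W = -(constantCoeff F * (((q : K) + 1) / 2)) := by
      rw [hW, map_sum, Finset.sum_eq_single 0]
      · have := hm 0 hq1
        rw [coeff_zero_eq_constantCoeff_apply, hH0, Nat.cast_zero, zero_sub] at this
        have hm0 : m 0 * q * constantCoeff F = -1 := by
          have h5 : (constantCoeff F)⁻¹ * constantCoeff F = 1 := inv_mul_cancel₀ ha
          linear_combination -constantCoeff F * this - h5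
        have hq0 : q ≠ 0 := by omega
        simp [hq0]
        field_simp
        linear_combination ((q : K) + 1) * hm0
      · intro j _ hj
        simp [hj]
      · simp; omega
    have key : ∑ j ∈ Finset.range q, C (m j) * X ^ j * E (q - j) - 1 = X ^ q * (W - H' * F) := by
      have h6 : ∑ j ∈ Finset.range q, C (m j) * X ^ j * E (q - j) =
          (∑ j ∈ Finset.range q, C (coeff j H) * X ^ j) * F + X ^ q * W := by
        rw [hW, Finset.mul_sum, Finset.sum_mul, ← Finset.sum_add_distrib]
        refine Finset.sum_congr rfl fun j hj ↦ ?_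
        have hj' : j < q := Finset.mem_range.1 hj
        have h7 : C (m j) * ((q - j : ℕ) : K⟦X⟧) = -C (coeff j H) := by
          rw [← hm j hj', ← map_natCast (C (R := K)), ← map_mul, ← map_neg, Nat.cast_sub hj'.le]
          congr 1
          ring
        rw [hE]
        linear_combination (-(X ^ j * F)) * h7
      rw [h6]
      linear_combination hFH - F * hH'
    rw [key]
    refine ⟨dvd_mul_right _ _, ?_⟩
    have h0 : coeff q (X ^ q * (W - H' * F)) = constantCoeff (W - H' * F) := by
      simpa using coeff_X_pow_mul (W - H' * F) q 0
    rw [h0, map_sub, map_mul, hW0, hqH]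
    ring

end Initial

/-- In `K[X]` this is Frobenius, `X ^ (p ^ n) - 1 = (X - 1) ^ (p ^ n)`, after cancelling `X - 1`;
evaluation then covers noncommutative `A`. -/
lemma sum_range_pow_eq_sub_one_pow {K A : Type*} [Field K] [Ring A] [Algebra K A] (p : ℕ)
    [Fact p.Prime] [CharP K p] (τ : A) (n : ℕ) :
    ∑ i ∈ Finset.range (p ^ n), τ ^ i = (τ - 1) ^ (p ^ n - 1) := by
  have h : ∑ i ∈ Finset.range (p ^ n), (Polynomial.X : Polynomial K) ^ i =
      (Polynomial.X - 1) ^ (p ^ n - 1) := by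
    have h1 : (Polynomial.X - 1 : Polynomial K) ≠ 0 := by
      simpa using Polynomial.X_sub_C_ne_zero (1 : K)
    refine mul_right_cancel₀ h1 ?_
    rw [geom_sum_mul, ← pow_succ, Nat.sub_add_cancel (pow_pos (Fact.out : p.Prime).pos n),
      sub_pow_char_pow, one_pow]
  simpa using congrArg (Polynomial.aeval τ) h

/-! ### Iterates of `T` and of `T - 1` -/

section Iterates

variable {K : Type*} [Field K]

lemma coe_toLinearMap_pow (T : K⟦X⟧ →ₐ[K] K⟦X⟧) (m : ℕ) (h : K⟦X⟧) :
    (T.toLinearMap ^ m) h = (T ^ m) h := by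
  induction m generalizing h with
  | zero => rfl
  | succ m ih => rw [pow_succ, pow_succ, Module.End.mul_apply, ih]; rfl

lemma X_pow_dvd_pow_map_X_sub (T : K⟦X⟧ →ₐ[K] K⟦X⟧) {Q : ℕ} (hT : X ^ (Q + 1) ∣ T X - X)
    (m : ℕ) : X ^ (Q + 1) ∣ (T ^ m) X - X := by
  induction m with
  | zero => simp
  | succ m ih =>
    rw [pow_succ' T, AlgHom.mul_apply]
    simpa using dvd_add (X_pow_dvd_map_sub T hT ((T ^ m) X)) ih

/-- Telescoping of `T ^ i (T w - w)` for `w = U / X ^ q`, with denominators cleared. -/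
lemma sum_pow_apply_mul (T : K⟦X⟧ →ₐ[K] K⟦X⟧) (hT : X ^ 2 ∣ T X - X) {q : ℕ} {U v : K⟦X⟧}
    (hv : v * X ^ q * T X ^ q = X ^ q * T U - U * T X ^ q) (m : ℕ) :
    (∑ i ∈ Finset.range m, T.toLinearMap ^ i) v * X ^ q * (T ^ m) X ^ q =
      X ^ q * (T ^ m) U - U * (T ^ m) X ^ q := by
  induction m with
  | zero => simp [mul_comm]
  | succ m ih =>
    have hX : (T ^ m) X ≠ 0 := fun h0 ↦ by
      have := X_pow_dvd_iff.1 (X_pow_dvd_pow_map_X_sub (Q := 1) T hT m) 1 (by norm_num)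
      simp [h0] at this
    refine mul_right_cancel₀ (pow_ne_zero q hX) ?_
    have h1 := congrArg (T ^ m) hv
    simp only [map_mul, map_pow, map_sub] at h1
    rw [Finset.sum_range_succ, LinearMap.add_apply, coe_toLinearMap_pow, pow_succ]
    simp only [AlgHom.mul_apply]
    linear_combination (T ^ m) (T X) ^ q * ih + X ^ q * h1

lemma iter_eq_pow_apply {f : K⟦X⟧} (hf : HasSubst f) (m : ℕ) :
    iter f m = (substAlgHom (R := K) hf ^ m) X := by
  induction m with
  | zero => rfl
  | succ m ih =>
    rw [pow_succ', AlgHom.mul_apply, ← ih, coe_substAlgHom]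
    rfl

lemma X_pow_dvd_sub_one_pow_apply (T : K⟦X⟧ →ₐ[K] K⟦X⟧) {q : ℕ} (hq1 : 1 ≤ q)
    (hT : X ^ (q + 1) ∣ T X - X) {k : ℕ} {h : K⟦X⟧} (hh : X ^ k ∣ h) (j : ℕ) :
    X ^ (k + j * q) ∣ ((T.toLinearMap - 1) ^ j) h := by
  induction j with
  | zero => simpa using hh
  | succ j ih =>
    rw [pow_succ', Module.End.mul_apply, add_one_mul, ← add_assoc]
    exact (map_sub_of_X_pow_dvd T hq1 hT ih).1

lemma order_sub_one_pow_apply (G : K⟦X⟧ →ₐ[K] K⟦X⟧) {Q k N : ℕ} (hQ : 1 ≤ Q)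
    (hG : (G X - X).order = ((Q + 1 : ℕ) : ℕ∞)) {h : K⟦X⟧} (hh : h.order = ((k * Q : ℕ) : ℕ∞))
    (hN : ∀ j < N, ((k + j : ℕ) * Q : K) ≠ 0) :
    (((G.toLinearMap - 1) ^ N) h).order = (((k + N) * Q : ℕ) : ℕ∞) := by
  induction N with
  | zero => simpa using hh
  | succ N ih =>
    rw [pow_succ', Module.End.mul_apply, ← add_assoc, add_one_mul]
    refine order_map_sub G hQ hG ?_ (ih fun j hj ↦ hN j (by omega))
    simpa using hN N (by omega)

end Iterates

end Ramification

/-! ### The criterion -/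

open PowerSeries Ramification in
theorem theorem2 (p : ℕ) (hp : p.Prime) (hodd : Odd p) (K : Type*) [Field K] [CharP K p]
    (q : ℕ) (hq1 : 1 ≤ q) (hqp : q ≤ p - 1)
    (f : K⟦X⟧) (hf0 : PowerSeries.constantCoeff f = 0)
    (hf : Ramification.mult f = (q : ℕ∞) + 1) :
    Ramification.IsQRamified p q f ↔ Ramification.resit f ≠ 0 := by
  have : Fact p.Prime := ⟨hp⟩
  have hp2 := hp.two_le
  have hp3 : 3 ≤ p := by
    rcases hodd with ⟨k, rfl⟩
    omega
  have hne : ∀ j, 1 ≤ j → j < p → (j : K) ≠ 0 := fun j h1 h2 h ↦ by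
    rw [CharP.cast_eq_zero_iff K p] at h
    exact absurd (Nat.le_of_dvd h1 h) (by omega)
  have hs := HasSubst.of_constantCoeff_zero' hf0
  obtain ⟨T, hTdef⟩ : ∃ T : K⟦X⟧ →ₐ[K] K⟦X⟧, T = substAlgHom (R := K) hs := ⟨_, rfl⟩
  have hit : ∀ m, iter f m = (T ^ m) X := hTdef ▸ iter_eq_pow_apply hs
  have hTX : T X = f := by rw [hTdef, substAlgHom_X]
  clear hTdef
  obtain ⟨U, v, hU, hv, hv1, hvq⟩ := exists_approximate_abel hq1
    (fun k h1 h2 ↦ hne k h1 (by omega)) (by exact_mod_cast hne 2 (by norm_num) (by omega)) T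
    (by rw [hTX, hf])
  have hT : (T X - X).order = ((q + 1 : ℕ) : ℕ∞) := by rw [hTX]; simpa [mult] using hf
  have hT2 : X ^ 2 ∣ T X - X := (pow_dvd_pow X (by omega)).trans (X_pow_dvd_of_order_eq hT)
  set δ := T.toLinearMap - 1 with hδ
  have hδm : ∀ m h, (δ ^ p ^ m) h = (T ^ p ^ m) h - h := by
    intro m h
    have h1 : δ ^ p ^ m = T.toLinearMap ^ p ^ m - 1 := by
      rw [← geom_sum_mul, sum_range_pow_eq_sub_one_pow (K := K), ← hδ, ← pow_succ,
        Nat.sub_add_cancel (pow_pos hp.pos m)]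
    rw [h1, LinearMap.sub_apply, coe_toLinearMap_pow]
    rfl
  let V : ℕ → K⟦X⟧ := fun n ↦ (δ ^ (p ^ n - 1)) v
  have hmult : ∀ n, ((T ^ p ^ n) X - X).order = (V n).order + q + 1 := by
    intro n
    refine order_map_X_sub_X (T ^ p ^ n) (X_pow_dvd_pow_map_X_sub (Q := 1) T hT2 _)
      (hne q hq1 (by omega)) hU ?_
    rw [← sum_pow_apply_mul T hT2 hv, sum_range_pow_eq_sub_one_pow (K := K)]
  have hlow : ∀ n, lowerRamification p f n = (V n).order + q := by
    intro n
    rw [lowerRamification, mult, hit, hmult]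
    exact (ENat.addLECancellable_of_ne_top ENat.one_ne_top).add_tsub_cancel_right
  -- `δ` kills constants, so only the deviation of `v` from `1` matters.
  have hδ1 : ∀ n, 1 ≤ n → (δ ^ n) v = (δ ^ n) (v - 1) := by
    intro n hn
    obtain ⟨n, rfl⟩ : ∃ m, n = m + 1 := ⟨n - 1, by omega⟩
    have : δ 1 = 0 := by simp [hδ]
    rw [map_sub, pow_succ, Module.End.mul_apply (δ ^ n) δ 1, this, map_zero, sub_zero]
  constructor
  · intro hram hres
    rw [hTX, hres, mul_zero, neg_zero] at hvq
    have hv2 : X ^ (q + 1) ∣ v - 1 := by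
      rw [X_pow_dvd_iff] at hv1 ⊢
      intro i hi
      rcases Nat.lt_succ_iff_lt_or_eq.1 hi with hi | rfl
      · exact hv1 i hi
      · exact hvq
    -- The exponent is `q + 1 + (p - 1) * q = q * p + 1`, one more than ramification at `n = 1`
    -- allows.
    have hd := X_pow_dvd_sub_one_pow_apply T hq1 (X_pow_dvd_of_order_eq hT) hv2 (p - 1)
    rw [← hδ, ← hδ1 _ (by omega)] at hd
    have h1 := hram 1
    rw [hlow] at h1
    have h2 : (V 1).order = ((q * p : ℕ) : ℕ∞) := by
      have h3 : (V 1).order ≠ ⊤ := by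
        intro h
        rw [h] at h1
        exact ENat.top_ne_natCast _ (by simpa only [top_add] using h1)
      obtain ⟨m, hm⟩ := ENat.ne_top_iff_exists.1 h3
      rw [← hm] at h1 ⊢
      norm_cast at h1 ⊢
      simp [Finset.sum_range_succ, mul_add] at h1
      omega
    have h4 := (order_eq_nat_iff_X_pow_dvd.1 h2).2
    refine h4 (X_pow_dvd_iff (n := q + 1 + (p - 1) * q).1 ?_ (q * p) ?_)
    · simpa [V] using hd
    · obtain ⟨p', rfl⟩ : ∃ r, p = r + 1 := ⟨p - 1, by omega⟩
      rw [Nat.add_sub_cancel]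
      nlinarith
  · intro hres
    have hvo : (v - 1).order = (q : ℕ∞) := by
      rw [order_eq_nat_iff_X_pow_dvd]
      refine ⟨hv1, ?_⟩
      rw [hvq, neg_ne_zero, hTX]
      refine mul_ne_zero ?_ hres
      rw [← hTX]
      exact (order_eq_nat_iff_X_pow_dvd.1 hT).2
    suffices H : ∀ n, (V n).order = ((p * (q * ∑ j ∈ Finset.range n, p ^ j) : ℕ) : ℕ∞) by
      intro n
      rw [hlow, H, geom_sum_succ]
      norm_cast
      ring
    intro n
    induction n with
    | zero =>
      rw [order_eq_nat_iff_X_pow_dvd]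
      have : coeff 0 (v - 1) = 0 := X_pow_dvd_iff.1 hv1 0 hq1
      rw [map_sub, sub_eq_zero] at this
      simp only [V, pow_zero, Nat.sub_self, Module.End.one_apply, Finset.range_zero,
        Finset.sum_empty, mul_zero, one_dvd, true_and, this]
      simp
    | succ n ih =>
      set s := p * (q * ∑ j ∈ Finset.range n, p ^ j) with hsdef
      have hps : p ∣ s := dvd_mul_right _ _
      have hG : ((T ^ p ^ n) X - X).order = ((s + q + 1 : ℕ) : ℕ∞) := by
        rw [hmult, ih]
        push_cast
        rfl
      have hcomm : (T (V n) - V n).order = ((s + 2 * q : ℕ) : ℕ∞) := by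
        have h1 : T (V n) - V n = (T ^ p ^ n) (v - 1) - (v - 1) := by
          rw [← hδm, ← hδ1 _ (pow_pos hp.pos n), ← Nat.sub_add_cancel (pow_pos hp.pos n),
            pow_succ']
          rfl
        rw [h1, order_map_sub _ (by omega) hG (hne q hq1 (by omega)) hvo]
        congr 1
        ring
      have h2 := order_map_sub_of_order_commuting hp3 T (T ^ p ^ n) hq1 (by omega) hT hps hG
        (X_pow_dvd_of_order_eq ih) hcomm
      have hQ : ((s + q : ℕ) : K) ≠ 0 := by
        rw [Nat.cast_add, (CharP.cast_eq_zero_iff K p s).2 hps, zero_add]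
        exact hne q hq1 (by omega)
      -- The orders met are `k * (s + q)` with `k = 2, …, p - 1`, all nonzero in `K`; the process
      -- stops just at `k = p`.
      have h3 := order_sub_one_pow_apply (T ^ p ^ n) (N := p - 2) (by omega) hG h2
        fun j hj ↦ mul_ne_zero (hne _ (by omega) (by omega)) hQ
      have hVs : V (n + 1) = (((T ^ p ^ n).toLinearMap - 1) ^ (p - 2))
          ((T ^ p ^ n) (V n) - V n) := by
        have h5 : (T ^ p ^ n).toLinearMap - 1 = δ ^ p ^ n := by
          ext h : 1
          rw [hδm]
          rfl
        rw [h5, ← hδm, ← pow_mul, ← Module.End.mul_apply, ← Module.End.mul_apply, ← pow_add,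
          ← pow_add]
        have h6 : p ^ (n + 1) - 1 = p ^ n * (p - 2) + (p ^ n + (p ^ n - 1)) := by
          have := pow_pos hp.pos n
          obtain ⟨r, hr⟩ : ∃ r, p = r + 2 := ⟨p - 2, by omega⟩
          have h7 : p ^ (n + 1) = p ^ n * (p - 2) + 2 * p ^ n := by
            rw [pow_succ, hr]; simp; ring
          omega
        simp only [V, h6, add_assoc]
      rw [hVs, h3, geom_sum_succ]
      congr 1
      rw [hsdef, show 2 + (p - 2) = p by omega]
      ring
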